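/- A normed vector lattice is a real vector lattice with a norm such that $|x|\le|y|$ implies $\|x\|\le\|y\|$; a Banach lattice is a norm complete one, and a Banach lattice is a KB-space if each of its norm bounded increasing sequences of positive elements is norm convergent. Operators are linear maps. An operator between vector lattices is order bounded if it maps order bounded sets to order bounded sets. For a vector lattice $E$ let $E^{\sim}$ denote its order dual (the order bounded linear functionals on $E$, ordered by $f\le g$ iff $f(x)\le g(x)$ for all $x\ge 0$) and $E^{\sim\sim}=(E^{\sim})^{\sim}$. A set $A\subseteq E$ is b-order bounded if its image under the canonical map $E\to E^{\sim\sim}$ is order bounded (if $E$ is a Banach lattice, $E^{\sim\sim}$ is the topological bidual $E''$). An operator from $E$ into a Banach space is b-weakly compact if it maps b-order bounded sets to relatively weakly compact sets. The modulus $|T|$ of an operator $T:E\to F$, if it exists, is the supremum of $\{T,-T\}$ in the space $\mathcal L(E,F)$ of all linear operators, ordered by $S\le R$ iff $Sx\le Rx$ for all $x\ge0$. **Theorem.** Let $E$ be a normed vector lattice, $F$ a Banach lattice and $T:E\to F$ a linear operator. 1. If $T$ is order bounded and $F$ is a KB-space, then the modulus $|T|$ exists, and both $T$ and $|T|$ are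 b-weakly compact. 2. If the modulus $|T|$ exists and is b-weakly compact, then $T$ is b-weakly compact. -/

import Mathlib

open Filter Topology

namespace RieszOperator

section Order

variable {E F : Type*} [AddCommGroup E] [Module ℝ E] [Preorder E]
  [AddCommGroup F] [Module ℝ F] [Preorder F]

/-- The operator order on the space `L(E, F)` of all linear operators between ordered vector
spaces: `S ≤ T` if and only if `S x ≤ T x` for every `x ≥ 0`, that is, `T - S` is positive. -/
scoped instance operatorPreorder : Preorder (E →ₗ[ℝ] F) where
  le S T := ∀ x : E, 0 ≤ x → S x ≤ T x
  le_refl _ _ _ := le_rfl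
  le_trans _ _ _ h₁ h₂ x hx := (h₁ x hx).trans (h₂ x hx)

theorem operator_le_def {S T : E →ₗ[ℝ] F} : S ≤ T ↔ ∀ x : E, 0 ≤ x → S x ≤ T x := Iff.rfl

/-- A subset of an ordered set is order bounded if it is contained in an order interval. -/
def IsOrderBounded {α : Type*} [Preorder α] (A : Set α) : Prop :=
  BddBelow A ∧ BddAbove A

/-- An operator is order bounded if it maps order bounded sets to order bounded sets. -/
def IsOrderBoundedOp (T : E →ₗ[ℝ] F) : Prop :=
  ∀ A : Set E, IsOrderBounded A → IsOrderBounded (T '' A)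

/-- `M` is the modulus `|T| = T ∨ (-T)` of the operator `T`: the supremum of `{T, -T}` in the
ordered space of all linear operators. -/
def IsModulus (M T : E →ₗ[ℝ] F) : Prop :=
  IsLUB {T, -T} M

theorem isOrderBounded_image_real_iff {G : Type*} [AddCommGroup G] [Module ℝ G]
    {f : G →ₗ[ℝ] ℝ} {A : Set G} :
    IsOrderBounded (f '' A) ↔ ∃ C : ℝ, ∀ x ∈ A, |f x| ≤ C := by
  constructor
  · rintro ⟨⟨l, hl⟩, ⟨u, hu⟩⟩
    refine ⟨max (-l) u, fun x hx => abs_le.2 ⟨?_, ?_⟩⟩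
    · have h1 := hl (Set.mem_image_of_mem f hx)
      have h2 := le_max_left (-l) u
      linarith
    · exact (hu (Set.mem_image_of_mem f hx)).trans (le_max_right _ _)
  · rintro ⟨C, hC⟩
    refine ⟨⟨-C, ?_⟩, ⟨C, ?_⟩⟩
    · rintro _ ⟨x, hx, rfl⟩
      exact (abs_le.1 (hC x hx)).1
    · rintro _ ⟨x, hx, rfl⟩
      exact (abs_le.1 (hC x hx)).2

variable (E) in
/-- The vector space of all order bounded linear functionals on `E`. -/
def orderBoundedFunctionals : Submodule ℝ (E →ₗ[ℝ] ℝ) where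
  carrier := {f | IsOrderBoundedOp f}
  zero_mem' := fun A _ => isOrderBounded_image_real_iff.2 ⟨0, fun x _ => by simp⟩
  add_mem' := by
    intro f g hf hg A hA
    obtain ⟨C, hC⟩ := isOrderBounded_image_real_iff.1 (hf A hA)
    obtain ⟨D, hD⟩ := isOrderBounded_image_real_iff.1 (hg A hA)
    exact isOrderBounded_image_real_iff.2
      ⟨C + D, fun x hx => (abs_add_le _ _).trans (add_le_add (hC x hx) (hD x hx))⟩
  smul_mem' := by
    intro c f hf A hA
    obtain ⟨C, hC⟩ := isOrderBounded_image_real_iff.1 (hf A hA)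
    refine isOrderBounded_image_real_iff.2 ⟨|c| * C, fun x hx => ?_⟩
    rw [LinearMap.smul_apply, smul_eq_mul, abs_mul]
    exact mul_le_mul_of_nonneg_left (hC x hx) (abs_nonneg c)

variable (E) in
/-- The order dual `E~` of `E`: the vector space of all order bounded linear functionals on `E`,
ordered by `f ≤ g` if and only if `f x ≤ g x` for every `x ≥ 0`. -/
def OrderBoundedDual : Type _ := orderBoundedFunctionals E

instance : AddCommGroup (OrderBoundedDual E) :=
  inferInstanceAs (AddCommGroup (orderBoundedFunctionals E))

instance : Module ℝ (OrderBoundedDual E) :=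
  inferInstanceAs (Module ℝ (orderBoundedFunctionals E))

instance : Preorder (OrderBoundedDual E) :=
  Preorder.lift (fun f : orderBoundedFunctionals E => (f : E →ₗ[ℝ] ℝ))

variable (E) in
/-- The inclusion of the order dual into the space of all linear functionals. -/
def OrderBoundedDual.toFunctional : OrderBoundedDual E →ₗ[ℝ] (E →ₗ[ℝ] ℝ) :=
  (orderBoundedFunctionals E).subtype

theorem OrderBoundedDual.le_def {f g : OrderBoundedDual E} :
    f ≤ g ↔ ∀ x : E, 0 ≤ x → OrderBoundedDual.toFunctional E f x ≤ OrderBoundedDual.toFunctional E g x := Iff.rfl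

variable (E) in
/-- The order bidual `E~~`: the order dual of the order dual. -/
abbrev OrderBoundedBidual : Type _ := OrderBoundedDual (OrderBoundedDual E)

end Order

section Lattice

variable {E : Type*} [AddCommGroup E] [Lattice E] [IsOrderedAddMonoid E] [Module ℝ E]

/-- The canonical map `E → E~~`, sending `x` to the evaluation `f ↦ f x`. -/
def toOrderBidual (x : E) : OrderBoundedBidual E :=
  ⟨(LinearMap.applyₗ x).comp (OrderBoundedDual.toFunctional E), by
    rintro A ⟨⟨l, hl⟩, ⟨u, hu⟩⟩
    refine ⟨⟨l.1 x⁺ - u.1 x⁻, ?_⟩, ⟨u.1 x⁺ - l.1 x⁻, ?_⟩⟩ <;>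
    · rintro _ ⟨f, hf, rfl⟩
      have h1 : f.1 x = f.1 x⁺ - f.1 x⁻ := by rw [← map_sub, posPart_sub_negPart]
      have h2 : l.1 x⁺ ≤ f.1 x⁺ := hl hf x⁺ (posPart_nonneg x)
      have h3 : l.1 x⁻ ≤ f.1 x⁻ := hl hf x⁻ (negPart_nonneg x)
      have h4 : f.1 x⁺ ≤ u.1 x⁺ := hu hf x⁺ (posPart_nonneg x)
      have h5 : f.1 x⁻ ≤ u.1 x⁻ := hu hf x⁻ (negPart_nonneg x)
      have h6 : ((LinearMap.applyₗ x).comp (OrderBoundedDual.toFunctional E)) f = f.1 x := rfl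
      rw [h6]
      linarith⟩

theorem toOrderBidual_apply (x : E) (f : OrderBoundedDual E) :
    OrderBoundedDual.toFunctional (OrderBoundedDual E) (toOrderBidual x) f = OrderBoundedDual.toFunctional E f x := rfl

/-- A subset of `E` is b-order bounded if it is order bounded in the bidual `E~~`. When `E` is a
Banach lattice, `E~~` is the topological bidual of `E` with its dual order. -/
def IsBOrderBounded (A : Set E) : Prop :=
  IsOrderBounded (toOrderBidual '' A)

/-- A linear operator is b-weakly compact if it maps b-order bounded sets to relatively weakly
compact sets, i.e. sets whose closure in the weak topology is weakly compact. -/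
def IsBWeaklyCompact {X : Type*} [NormedAddCommGroup X] [NormedSpace ℝ X]
    (T : E →ₗ[ℝ] X) : Prop :=
  ∀ A : Set E, IsBOrderBounded A → IsCompact (closure (toWeakSpace ℝ X '' (T '' A)))

end Lattice

/-- The defining property of a KB-space, for a Banach lattice `F`: each increasing norm bounded
sequence of positive elements of `F` is norm convergent. -/
def IsKBSpace (F : Type*) [NormedAddCommGroup F] [Lattice F] [HasSolidNorm F]
    [IsOrderedAddMonoid F] [NormedSpace ℝ F] [IsOrderedModule ℝ F] [CompleteSpace F] : Prop :=
  ∀ u : ℕ → F, Monotone u → (∀ n, 0 ≤ u n) → (∃ C : ℝ, ∀ n, ‖u n‖ ≤ C) →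
    ∃ y : F, Tendsto u atTop (𝓝 y)

end RieszOperator

open scoped RieszOperator

namespace RieszOperator

set_option linter.unusedSectionVars false

/-! ### Functionals, Riesz–Kantorovich and the modulus -/

section VectorLattice

variable {E : Type*} [AddCommGroup E] [Lattice E] [IsOrderedAddMonoid E] [Module ℝ E]
  [IsOrderedModule ℝ E]

/-! A modulus `M` of `T` satisfies `|T x| ≤ M |x|`, so both statements reduce to
`isBWeaklyCompact_of_dominated`: it is enough that the positive operator `M` sends increasing
positive b-order bounded sequences to Cauchy sequences. If `F` is a KB-space, this follows from
uniform boundedness, and `M` exists by Riesz–Kantorovich since `F` is Dedekind complete. If `M` is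
b-weakly compact, it holds because an increasing sequence with a weak cluster point converges in
norm.

For the reduction, the positive parts of a b-order bounded set lie in a solid sup-closed set `S`
(`belowBidual`) whose increasing sequences are again b-order bounded; negative parts are handled
alike. Up to a small error in `‖M ·‖`, `S` shrinks to an interval `[0, s]`
(`exists_mem_norm_map_sub_inf_le`). There, smallness of one positive functional `f` forces smallness
of `‖M ·‖` (`exists_functional_absolutelyContinuous`).

The functional `f` also carries a Hilbert-like energy, morally the integral of `x² / s`, with a
parallelogram inequality. A near-minimal point `y₀` is then `f`-close to every convex member of a
given ultrafilter (`exists_forall_convex_mem_apply_abs_sub_le`). Applied to the slabs where `g ∘ T`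
is near its ultrafilter limit, this makes `T y₀` an approximate weak limit; completeness of `F`
turns approximate limits into a true one. So every ultrafilter on the image converges weakly. -/

theorem posPart_add_le (x y : E) : (x + y)⁺ ≤ x⁺ + y⁺ :=
  sup_le (add_le_add (le_posPart x) (le_posPart y))
    (add_nonneg (posPart_nonneg x) (posPart_nonneg y))

theorem posPart_smul_of_pos {c : ℝ} (hc : 0 < c) (x : E) : (c • x)⁺ = c • x⁺ := by
  refine le_antisymm (sup_le (smul_le_smul_of_nonneg_left (le_posPart x) hc.le)
    (smul_nonneg hc.le (posPart_nonneg x))) ?_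
  rw [← le_inv_smul_iff_of_pos hc]
  refine sup_le ?_ (smul_nonneg (inv_nonneg.2 hc.le) (posPart_nonneg _))
  rw [le_inv_smul_iff_of_pos hc]
  exact le_posPart _

theorem abs_smul_of_pos {c : ℝ} (hc : 0 < c) (x : E) : |c • x| = c • |x| := by
  rw [← posPart_add_negPart, ← posPart_neg, ← smul_neg, posPart_smul_of_pos hc,
    posPart_smul_of_pos hc, ← smul_add, posPart_neg, posPart_add_negPart]

theorem smul_le_smul_abs (c : ℝ) (x : E) : c • x ≤ |c| • |x| := by
  rcases le_total 0 c with hc | hc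
  · rw [abs_of_nonneg hc]
    exact smul_le_smul_of_nonneg_left (le_abs_self x) hc
  · rw [abs_of_nonpos hc, ← neg_smul_neg]
    exact smul_le_smul_of_nonneg_left (neg_le_abs x) (neg_nonneg.2 hc)

/-- Hahn–Banach: a sublinear functional is supported by a linear one at each point. -/
theorem exists_linear_le_sublinear {V : Type*} [AddCommGroup V] [Module ℝ V] (N : V → ℝ)
    (N_hom : ∀ c : ℝ, 0 < c → ∀ x, N (c • x) = c * N x)
    (N_add : ∀ x y, N (x + y) ≤ N x + N y) (z : V) :
    ∃ g : V →ₗ[ℝ] ℝ, g z = N z ∧ ∀ x, g x ≤ N x := by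
  have N_0 : N 0 = 0 := by
    have := N_hom 2 two_pos 0
    rw [smul_zero] at this
    linarith
  by_cases hz : z = 0
  · obtain ⟨g, -, hg⟩ := exists_extension_of_le_sublinear (⊥ : V →ₗ.[ℝ] ℝ) N N_hom N_add (by
      rintro ⟨x, hx⟩
      obtain rfl : x = 0 := (Submodule.mem_bot ℝ).1 hx
      rw [N_0]
      exact (map_zero (⊥ : V →ₗ.[ℝ] ℝ).toFun).le)
    exact ⟨g, by rw [hz, map_zero, N_0], hg⟩
  · obtain ⟨g, hg, hgN⟩ := exists_extension_of_le_sublinear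
      (LinearPMap.mkSpanSingleton (K := ℝ) z (N z) hz) N N_hom N_add (by
      rintro ⟨x, hx⟩
      obtain ⟨c, rfl⟩ := Submodule.mem_span_singleton.1 hx
      rw [LinearPMap.mkSpanSingleton'_apply, smul_eq_mul]
      change c * N z ≤ N (c • z)
      rcases lt_trichotomy c 0 with hc | rfl | hc
      · have h1 := N_hom (-c) (neg_pos.2 hc) z
        have h2 := N_add (c • z) ((-c) • z)
        rw [neg_smul, add_neg_cancel, N_0, ← neg_smul, h1] at h2
        linarith
      · simp [N_0]
      · exact (N_hom c hc z).ge)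
    refine ⟨g, ?_, hgN⟩
    have h := hg ⟨z, Submodule.mem_span_singleton_self z⟩
    rw [h]
    have := LinearPMap.mkSpanSingleton_apply ℝ ℝ (σ := RingHom.id ℝ) hz (N z)
    exact this

/-- For a positive functional `f` and a point `z` there is a functional `g` with `0 ≤ g ≤ f` and
`g z = f z⁺`. -/
theorem exists_functional_apply_eq_posPart {f : E →ₗ[ℝ] ℝ} (hf : 0 ≤ f) (z : E) :
    ∃ g : E →ₗ[ℝ] ℝ, 0 ≤ g ∧ g ≤ f ∧ g z = f z⁺ := by
  have hmono : ∀ x y : E, x ≤ y → f x ≤ f y := fun x y h => by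
    have : 0 ≤ f (y - x) := hf _ (sub_nonneg.2 h)
    rw [map_sub] at this
    linarith
  -- This majorant vanishes on the negative cone and equals `f` on the positive one, which forces `0
  -- ≤ g ≤ f`.
  obtain ⟨g, hgz, hg⟩ := exists_linear_le_sublinear (fun x : E => f x⁺)
    (fun c hc x => by simp only [posPart_smul_of_pos hc, map_smul, smul_eq_mul])
    (fun x y => by
      rw [← map_add]
      exact hmono _ _ (posPart_add_le x y)) z
  refine ⟨g, fun x hx => ?_, fun x hx => ?_, hgz⟩
  · have := hg (-x)
    rw [posPart_neg, negPart_eq_zero.2 hx, map_zero, map_neg] at this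
    change 0 ≤ g x
    linarith
  · have := hg x
    rwa [posPart_of_nonneg hx] at this

theorem map_le_map_of_nonneg {F : Type*} [AddCommGroup F] [PartialOrder F] [IsOrderedAddMonoid F]
    [Module ℝ F] {f : E →ₗ[ℝ] F} (hf : 0 ≤ f) {x y : E} (h : x ≤ y) : f x ≤ f y := by
  have : 0 ≤ f (y - x) := hf _ (sub_nonneg.2 h)
  rwa [map_sub, sub_nonneg] at this

theorem isOrderBoundedOp_of_nonneg {f : E →ₗ[ℝ] ℝ} (hf : 0 ≤ f) : IsOrderBoundedOp f := by
  rintro A ⟨⟨l, hl⟩, ⟨u, hu⟩⟩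
  refine ⟨⟨f l, ?_⟩, ⟨f u, ?_⟩⟩
  · rintro _ ⟨x, hx, rfl⟩
    exact map_le_map_of_nonneg hf (hl hx)
  · rintro _ ⟨x, hx, rfl⟩
    exact map_le_map_of_nonneg hf (hu hx)

/-- Riesz decomposition, with `u ⊓ x` as first summand; it gives subadditivity of the
Riesz–Kantorovich supremum. -/
theorem Icc_zero_add {x y : E} (hx : 0 ≤ x) (hy : 0 ≤ y) {u : E} (hu : u ∈ Set.Icc 0 (x + y)) :
    ∃ v ∈ Set.Icc 0 x, ∃ w ∈ Set.Icc 0 y, v + w = u := by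
  refine ⟨u ⊓ x, ⟨le_inf hu.1 hx, inf_le_right⟩, u - u ⊓ x,
    ⟨sub_nonneg.2 inf_le_left, ?_⟩, add_sub_cancel _ _⟩
  rw [sub_le_iff_le_add, add_inf]
  exact le_inf (le_add_of_nonneg_left hy) (by rw [add_comm]; exact hu.2)

/-- A map that is additive and positively homogeneous on the positive cone extends to a linear
operator. -/
theorem exists_linear_extension_of_cone {F : Type*} [AddCommGroup F] [Module ℝ F] (m : E → F)
    (m_add : ∀ x y, 0 ≤ x → 0 ≤ y → m (x + y) = m x + m y)
    (m_smul : ∀ (c : ℝ) (x), 0 < c → 0 ≤ x → m (c • x) = c • m x) :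
    ∃ P : E →ₗ[ℝ] F, ∀ x, 0 ≤ x → P x = m x := by
  have m_zero : m 0 = 0 := by
    have := m_add 0 0 le_rfl le_rfl
    rw [add_zero] at this
    exact left_eq_add.1 this
  -- The extension does not depend on how a vector is written as a difference of positive ones.
  have key : ∀ a b : E, 0 ≤ a → 0 ≤ b → m (a - b)⁺ - m (a - b)⁻ = m a - m b := by
    intro a b ha hb
    rw [sub_eq_sub_iff_add_eq_add, ← m_add _ _ (posPart_nonneg _) hb,
      ← m_add _ _ ha (negPart_nonneg _)]
    congr 1
    rw [← sub_eq_sub_iff_add_eq_add, posPart_sub_negPart]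
  have hsub : ∀ x : E, x = x⁺ - x⁻ := fun x => (posPart_sub_negPart x).symm
  refine ⟨{ toFun := fun x => m x⁺ - m x⁻, map_add' := fun x y => ?_,
            map_smul' := fun c x => ?_ }, fun x hx => ?_⟩
  · have h : x + y = (x⁺ + y⁺) - (x⁻ + y⁻) := by
      rw [add_sub_add_comm, ← hsub, ← hsub]
    rw [h, key _ _ (add_nonneg (posPart_nonneg x) (posPart_nonneg y))
      (add_nonneg (negPart_nonneg x) (negPart_nonneg y)),
      m_add _ _ (posPart_nonneg x) (posPart_nonneg y),
      m_add _ _ (negPart_nonneg x) (negPart_nonneg y), add_sub_add_comm]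
  · rcases lt_trichotomy c 0 with hc | rfl | hc
    · have h : c • x = (-c) • x⁻ - (-c) • x⁺ := by
        rw [← smul_sub, ← neg_sub, ← hsub, smul_neg, neg_smul, neg_neg]
      have hc' := neg_pos.2 hc
      rw [h, key _ _ (smul_nonneg hc'.le (negPart_nonneg x))
        (smul_nonneg hc'.le (posPart_nonneg x)), m_smul _ _ hc' (negPart_nonneg x),
        m_smul _ _ hc' (posPart_nonneg x), ← smul_sub, RingHom.id_apply, neg_smul, ← smul_neg,
        neg_sub]
    · simp
    · have h : c • x = c • x⁺ - c • x⁻ := by rw [← smul_sub, ← hsub]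
      rw [h, key _ _ (smul_nonneg hc.le (posPart_nonneg x))
        (smul_nonneg hc.le (negPart_nonneg x)), m_smul _ _ hc (negPart_nonneg x),
        m_smul _ _ hc (posPart_nonneg x), ← smul_sub, RingHom.id_apply]
  · change m x⁺ - m x⁻ = m x
    rw [posPart_of_nonneg hx, negPart_eq_zero.2 hx, m_zero, sub_zero]

section RieszKantorovich

variable {F : Type*} [AddCommGroup F] [Lattice F] [IsOrderedAddMonoid F] [Module ℝ F]
  [IsOrderedModule ℝ F]

/-- Riesz–Kantorovich: the positive part of an order bounded operator into a Dedekind complete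
vector lattice. -/
theorem exists_posPart_operator
    (hF : ∀ B : Set F, B.Nonempty → BddAbove B → ∃ y, IsLUB B y)
    {T : E →ₗ[ℝ] F} (hT : IsOrderBoundedOp T) :
    ∃ P : E →ₗ[ℝ] F, ∀ x, 0 ≤ x → IsLUB (T '' Set.Icc 0 x) (P x) := by
  -- Off the positive cone the chosen value is arbitrary and never used.
  have hex : ∀ x : E, ∃ y, 0 ≤ x → IsLUB (T '' Set.Icc 0 x) y := by
    intro x
    by_cases hx : 0 ≤ x
    · obtain ⟨y, hy⟩ := hF (T '' Set.Icc 0 x) ⟨T 0, 0, ⟨le_rfl, hx⟩, rfl⟩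
        (hT _ ⟨bddBelow_Icc, bddAbove_Icc⟩).2
      exact ⟨y, fun _ => hy⟩
    · exact ⟨0, fun h => absurd h hx⟩
  choose m hm using hex
  obtain ⟨P, hP⟩ := exists_linear_extension_of_cone m (fun x y hx hy => by
      apply le_antisymm
      · refine (hm _ (add_nonneg hx hy)).2 ?_
        rintro _ ⟨u, hu, rfl⟩
        obtain ⟨v, hv, w, hw, rfl⟩ := Icc_zero_add hx hy hu
        rw [map_add]
        exact add_le_add ((hm x hx).1 ⟨v, hv, rfl⟩) ((hm y hy).1 ⟨w, hw, rfl⟩)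
      · rw [← le_sub_iff_add_le]
        refine (hm x hx).2 ?_
        rintro _ ⟨v, hv, rfl⟩
        rw [le_sub_comm]
        refine (hm y hy).2 ?_
        rintro _ ⟨w, hw, rfl⟩
        rw [le_sub_iff_add_le', ← map_add]
        exact (hm _ (add_nonneg hx hy)).1
          ⟨v + w, ⟨add_nonneg hv.1 hw.1, add_le_add hv.2 hw.2⟩, rfl⟩)
    (fun c x hc hx => by
      have hcx := smul_nonneg hc.le hx
      apply le_antisymm
      · refine (hm _ hcx).2 ?_
        rintro _ ⟨u, hu, rfl⟩
        rw [← inv_smul_le_iff_of_pos hc, ← map_smul]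
        refine (hm x hx).1 ⟨_, ⟨smul_nonneg (inv_nonneg.2 hc.le) hu.1, ?_⟩, rfl⟩
        rw [inv_smul_le_iff_of_pos hc]
        exact hu.2
      · rw [← le_inv_smul_iff_of_pos hc]
        refine (hm x hx).2 ?_
        rintro _ ⟨u, hu, rfl⟩
        rw [le_inv_smul_iff_of_pos hc, ← map_smul]
        exact (hm _ hcx).1
          ⟨_, ⟨smul_nonneg hc.le hu.1, smul_le_smul_of_nonneg_left hu.2 hc.le⟩, rfl⟩)
  exact ⟨P, fun x hx => by rw [hP x hx]; exact hm x hx⟩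

/-- An order bounded operator into a Dedekind complete vector lattice has a modulus. -/
theorem exists_isModulus
    (hF : ∀ B : Set F, B.Nonempty → BddAbove B → ∃ y, IsLUB B y)
    {T : E →ₗ[ℝ] F} (hT : IsOrderBoundedOp T) : ∃ M : E →ₗ[ℝ] F, IsModulus M T := by
  obtain ⟨P, hP⟩ := exists_posPart_operator hF hT
  -- The identity `|T| = 2 T⁺ - T`.
  refine ⟨(2 : ℝ) • P - T, ?_, ?_⟩
  · have h0 : ∀ x : E, 0 ≤ x → 0 ≤ P x := fun x hx => by
      have := (hP x hx).1 ⟨0, ⟨le_rfl, hx⟩, rfl⟩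
      rwa [map_zero] at this
    have h1 : ∀ x : E, 0 ≤ x → T x ≤ P x := fun x hx => (hP x hx).1 ⟨x, ⟨hx, le_rfl⟩, rfl⟩
    rintro _ (rfl | rfl)
    · intro x hx
      rw [LinearMap.sub_apply, LinearMap.smul_apply, two_smul, le_sub_iff_add_le]
      exact add_le_add (h1 x hx) (h1 x hx)
    · intro x hx
      rw [LinearMap.sub_apply, LinearMap.smul_apply, LinearMap.neg_apply, two_smul,
        le_sub_iff_add_le, neg_add_cancel]
      exact add_nonneg (h0 x hx) (h0 x hx)
  · intro S hS
    have h1 : T ≤ S := hS (by simp)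
    have h2 : -T ≤ S := hS (by simp)
    have h3 : 0 ≤ S + T := fun x hx => by
      have := h2 x hx
      rw [LinearMap.neg_apply, neg_le_iff_add_nonneg] at this
      exact this
    intro x hx
    rw [LinearMap.sub_apply, sub_le_iff_le_add, LinearMap.smul_apply,
      ← le_inv_smul_iff_of_pos two_pos]
    refine (hP x hx).2 ?_
    rintro _ ⟨u, hu, rfl⟩
    rw [le_inv_smul_iff_of_pos two_pos, two_smul]
    have h4 := map_le_map_of_nonneg h3 hu.2
    exact (add_le_add_left (h1 u hu.1) _).trans h4

theorem IsModulus.nonneg {M T : E →ₗ[ℝ] F} (h : IsModulus M T) : 0 ≤ M := by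
  intro x hx
  have h1 : T x ≤ M x := h.1 (by simp) x hx
  have h2 : (-T) x ≤ M x := h.1 (by simp) x hx
  have h3 := add_le_add h1 h2
  rw [LinearMap.neg_apply, add_neg_cancel, ← two_smul ℝ (M x)] at h3
  change 0 ≤ M x
  have h4 : (0 : F) ≤ (2 : ℝ)⁻¹ • ((2 : ℝ) • M x) := smul_nonneg (by norm_num) h3
  rwa [inv_smul_smul₀ two_ne_zero] at h4

theorem IsModulus.abs_apply_le {M T : E →ₗ[ℝ] F} (h : IsModulus M T) (x : E) :
    |T x| ≤ M |x| := by
  have h1 : ∀ x : E, 0 ≤ x → |T x| ≤ M x := fun x hx =>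
    sup_le (h.1 (by simp : T ∈ ({T, -T} : Set _)) x hx)
      (h.1 (by simp : -T ∈ ({T, -T} : Set _)) x hx)
  calc |T x| = |T x⁺ - T x⁻| := by rw [← map_sub, posPart_sub_negPart]
    _ ≤ |T x⁺| + |T x⁻| := by
      rw [sub_eq_add_neg, ← abs_neg (T x⁻)]
      exact abs_add_le _ _
    _ ≤ M x⁺ + M x⁻ := add_le_add (h1 _ (posPart_nonneg x)) (h1 _ (negPart_nonneg x))
    _ = M |x| := by rw [← map_add, posPart_add_negPart]

end RieszKantorovich

/-- Each order bounded functional lies below a positive one. -/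
theorem exists_nonneg_functional_ge {f : E →ₗ[ℝ] ℝ} (hf : IsOrderBoundedOp f) :
    ∃ g : E →ₗ[ℝ] ℝ, 0 ≤ g ∧ f ≤ g := by
  obtain ⟨M, hM⟩ := exists_isModulus (fun _ h h' => Real.exists_isLUB h h') hf
  exact ⟨M, hM.nonneg, hM.1 (by simp)⟩

end VectorLattice

/-! ### A quadratic energy and near-minimal points -/

section SquareEnergy

variable {E : Type*} [AddCommGroup E] [Lattice E] [IsOrderedAddMonoid E] [Module ℝ E]
  [IsOrderedModule ℝ E]

/-- The finite suprema of `2 a x - a² s`, which increase to the square of `x` in an algebra with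
unit `s`. -/
noncomputable def squareApprox (s x : E) (A : {A : Finset ℝ // A.Nonempty}) : E :=
  A.1.sup' A.2 fun a => (2 * a) • x - (a ^ 2) • s

theorem le_squareApprox (s x : E) (A : {A : Finset ℝ // A.Nonempty}) {a : ℝ} (ha : a ∈ A.1) :
    (2 * a) • x - (a ^ 2) • s ≤ squareApprox s x A :=
  Finset.le_sup' (fun a => (2 * a) • x - (a ^ 2) • s) ha

theorem squareApprox_le {s x : E} (hx : |x| ≤ s) (A : {A : Finset ℝ // A.Nonempty}) :
    squareApprox s x A ≤ s := by
  have hs : 0 ≤ s := (abs_nonneg x).trans hx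
  refine Finset.sup'_le _ _ fun a _ => ?_
  rw [sub_le_iff_le_add]
  calc (2 * a) • x ≤ |2 * a| • |x| := smul_le_smul_abs _ _
    _ ≤ |2 * a| • s := smul_le_smul_of_nonneg_left hx (abs_nonneg _)
    _ ≤ (1 + a ^ 2) • s := smul_le_smul_of_nonneg_right (by
        rw [abs_le]; constructor <;> nlinarith [sq_nonneg (1 - a), sq_nonneg (1 + a)]) hs
    _ = s + a ^ 2 • s := by rw [add_smul, one_smul]

/-- The energy of `x`: the value of a positive functional `f` at the square of `x` in an algebra
with unit `s`. -/
noncomputable def squareEnergy (f : E →ₗ[ℝ] ℝ) (s x : E) : ℝ :=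
  ⨆ A, f (squareApprox s x A)

variable {f : E →ₗ[ℝ] ℝ} {s : E}

theorem bddAbove_squareEnergy (hf : 0 ≤ f) {x : E} (hx : |x| ≤ s) :
    BddAbove (Set.range fun A => f (squareApprox s x A)) := by
  refine ⟨f s, ?_⟩
  rintro _ ⟨A, rfl⟩
  exact map_le_map_of_nonneg hf (squareApprox_le hx A)

instance : Nonempty {A : Finset ℝ // A.Nonempty} := ⟨⟨{0}, Finset.singleton_nonempty 0⟩⟩

theorem squareEnergy_le (hf : 0 ≤ f) {x : E} (hx : |x| ≤ s) : squareEnergy f s x ≤ f s :=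
  ciSup_le fun A => map_le_map_of_nonneg hf (squareApprox_le hx A)

theorem le_squareEnergy (hf : 0 ≤ f) {x : E} (hx : |x| ≤ s) (A : {A : Finset ℝ // A.Nonempty}) :
    f (squareApprox s x A) ≤ squareEnergy f s x :=
  le_ciSup (bddAbove_squareEnergy hf hx) A

theorem squareEnergy_nonneg (hf : 0 ≤ f) {x : E} (hx : |x| ≤ s) : 0 ≤ squareEnergy f s x := by
  refine le_trans ?_ (le_squareEnergy hf hx ⟨{0}, Finset.singleton_nonempty 0⟩)
  have : 0 ≤ squareApprox s x ⟨{0}, Finset.singleton_nonempty 0⟩ := by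
    have := le_squareApprox s x ⟨{0}, Finset.singleton_nonempty 0⟩ (Finset.mem_singleton_self 0)
    simpa using this
  exact hf _ this

/-- The two parameters `a` and `-a` together produce `|x|`. This is how small energy yields small `f
|x|`. -/
theorem apply_abs_le_squareEnergy (hf : 0 ≤ f) {x : E} (hx : |x| ≤ s) {a : ℝ} (ha : 0 < a) :
    2 * a * f |x| - a ^ 2 * f s ≤ squareEnergy f s x := by
  let A : {A : Finset ℝ // A.Nonempty} := ⟨{a, -a}, Finset.insert_nonempty _ _⟩
  have h1 := le_squareApprox s x A (a := a) (by simp [A])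
  have h2 := le_squareApprox s x A (a := -a) (by simp [A])
  rw [sub_le_iff_le_add] at h1 h2
  rw [neg_sq, mul_neg, neg_smul, ← smul_neg] at h2
  have h3 : (2 * a) • |x| ≤ squareApprox s x A + a ^ 2 • s := by
    rw [← le_inv_smul_iff_of_pos (by positivity)] at h1 h2 ⊢
    exact sup_le h1 h2
  have h4 := map_le_map_of_nonneg hf h3
  rw [map_add, map_smul, map_smul, smul_eq_mul, smul_eq_mul] at h4
  have h5 := le_squareEnergy hf hx A
  linarith

/-- Parameters `a`, `b` for the half sum and half difference correspond to `a + b` for `x` and `a -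
b` for `y`, since `(a + b)² + (a - b)² = 2 (a² + b²)`. -/
theorem squareEnergy_parallelogram (hf : 0 ≤ f) {x y : E} (hx : |x| ≤ s) (hy : |y| ≤ s) :
    2 * squareEnergy f s ((2⁻¹ : ℝ) • (x + y)) + 2 * squareEnergy f s ((2⁻¹ : ℝ) • (x - y)) ≤
      squareEnergy f s x + squareEnergy f s y := by
  have key : ∀ A B, 2 * f (squareApprox s ((2⁻¹ : ℝ) • (x + y)) A) +
      2 * f (squareApprox s ((2⁻¹ : ℝ) • (x - y)) B) ≤
        squareEnergy f s x + squareEnergy f s y := by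
    intro A B
    let C : {A : Finset ℝ // A.Nonempty} := ⟨Finset.image₂ (· + ·) A.1 B.1, A.2.image₂ B.2⟩
    let D : {A : Finset ℝ // A.Nonempty} := ⟨Finset.image₂ (· - ·) A.1 B.1, A.2.image₂ B.2⟩
    have h : squareApprox s ((2⁻¹ : ℝ) • (x + y)) A + squareApprox s ((2⁻¹ : ℝ) • (x - y)) B ≤
        (2⁻¹ : ℝ) • (squareApprox s x C + squareApprox s y D) := by
      rw [← le_sub_iff_add_le]
      refine Finset.sup'_le _ _ fun a ha => ?_
      rw [le_sub_comm]
      refine Finset.sup'_le _ _ fun b hb => ?_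
      rw [le_sub_iff_add_le']
      have h1 := le_squareApprox s x C (Finset.mem_image₂_of_mem ha hb)
      have h2 := le_squareApprox s y D (Finset.mem_image₂_of_mem ha hb)
      refine le_trans (le_of_eq ?_)
        (smul_le_smul_of_nonneg_left (add_le_add h1 h2) (by norm_num : (0 : ℝ) ≤ 2⁻¹))
      module
    have h3 := map_le_map_of_nonneg hf h
    rw [map_add, map_smul, map_add, smul_eq_mul] at h3
    have h4 := le_squareEnergy hf hx C
    have h5 := le_squareEnergy hf hy D
    linarith
  have h1 : squareEnergy f s ((2⁻¹ : ℝ) • (x + y)) ≤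
      (squareEnergy f s x + squareEnergy f s y) / 2 - squareEnergy f s ((2⁻¹ : ℝ) • (x - y)) := by
    refine ciSup_le fun A => ?_
    rw [le_sub_comm]
    refine ciSup_le fun B => ?_
    have := key A B
    linarith
  linarith

/-- The convex sets of a filter on `[0, s]` all meet some `f`-small neighbourhood of a point. -/
theorem exists_forall_convex_mem_apply_abs_sub_le (hf : 0 ≤ f) (U : Filter E) [U.NeBot]
    (hU : Set.Icc 0 s ∈ U) {δ : ℝ} (hδ : 0 < δ) :
    ∃ y₀ ∈ Set.Icc 0 s, ∀ D ∈ U, Convex ℝ D → ∃ y ∈ D ∩ Set.Icc 0 s, f |y₀ - y| ≤ δ := by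
  have habs : ∀ {x : E}, x ∈ Set.Icc 0 s → |x| ≤ s := fun h => by
    rw [abs_of_nonneg h.1]; exact h.2
  have hs : 0 ≤ s := by
    obtain ⟨x, hx⟩ := U.nonempty_of_mem hU
    exact hx.1.trans hx.2
  have hfs : 0 ≤ f s := hf s hs
  -- Chosen so that `a * f s ≤ δ / 2`; the `+ 1` covers `f s = 0`.
  set a : ℝ := δ / (2 * (f s + 1)) with ha_def
  have ha : 0 < a := by positivity
  have haf : a * f s ≤ δ / 2 := by
    have : a * (f s + 1) = δ / 2 := by rw [ha_def]; field_simp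
    nlinarith
  set κ : ℝ := a * δ / 2
  have hκ : 0 < κ := by positivity
  let R : Set ℝ := {t | ∃ C ∈ U, Convex ℝ C ∧ C ⊆ Set.Icc 0 s ∧ ∀ y ∈ C, t ≤ squareEnergy f s y}
  have hR : R.Nonempty := ⟨0, Set.Icc 0 s, hU, convex_Icc 0 s, subset_rfl,
    fun y hy => squareEnergy_nonneg hf (habs hy)⟩
  have hRb : BddAbove R := by
    refine ⟨f s, ?_⟩
    rintro t ⟨C, hC, -, hCs, ht⟩
    obtain ⟨y, hy⟩ := U.nonempty_of_mem hC
    exact (ht y hy).trans (squareEnergy_le hf (habs (hCs hy)))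
  obtain ⟨t, ⟨C, hCU, hCc, hCs, htC⟩, ht⟩ := exists_lt_of_lt_csSup hR (sub_lt_self (sSup R) hκ)
  -- Otherwise `D ∩ C` would put `t + κ > sSup R` into `R`.
  have hD : ∀ D ∈ U, Convex ℝ D → ∃ y ∈ D ∩ C, squareEnergy f s y < t + κ := by
    intro D hDU hDc
    by_contra! hcon
    have := le_csSup hRb (a := t + κ) ⟨D ∩ C, inter_mem hDU hCU, hDc.inter hCc,
      Set.inter_subset_right.trans hCs, hcon⟩
    linarith
  obtain ⟨y₀, ⟨-, hy₀C⟩, hy₀⟩ := hD Set.univ univ_mem convex_univ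
  refine ⟨y₀, hCs hy₀C, fun D hDU hDc => ?_⟩
  obtain ⟨y, ⟨hyD, hyC⟩, hy⟩ := hD D hDU hDc
  refine ⟨y, ⟨hyD, hCs hyC⟩, ?_⟩
  have hmid : (2⁻¹ : ℝ) • (y₀ + y) ∈ C := by
    rw [smul_add]
    exact hCc hy₀C hyC (by norm_num) (by norm_num) (by norm_num)
  have h1 := htC _ hmid
  -- The midpoint has energy at least `t` and the endpoints less than `t + κ`, so the half
  -- difference has energy below `κ`.
  have h2 := squareEnergy_parallelogram hf (habs (hCs hy₀C)) (habs (hCs hyC))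
  have hle : |y₀ - y| ≤ s := by
    rw [abs_le']
    have h3 := hCs hy₀C
    have h4 := hCs hyC
    constructor
    · exact (sub_le_self _ h4.1).trans h3.2
    · rw [neg_sub]; exact (sub_le_self _ h3.1).trans h4.2
  have habs' : |(2⁻¹ : ℝ) • (y₀ - y)| = (2⁻¹ : ℝ) • |y₀ - y| :=
    abs_smul_of_pos (by norm_num) _
  have hle' : |(2⁻¹ : ℝ) • (y₀ - y)| ≤ s := by
    rw [habs']
    refine le_trans ?_ hle
    calc (2⁻¹ : ℝ) • |y₀ - y| ≤ (1 : ℝ) • |y₀ - y| :=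
          smul_le_smul_of_nonneg_right (by norm_num) (abs_nonneg _)
      _ = _ := one_smul _ _
  have h3 := apply_abs_le_squareEnergy hf hle' ha
  rw [habs', map_smul, smul_eq_mul] at h3
  have h4 : a * f |y₀ - y| ≤ a * δ := by
    have : a * (a * f s) ≤ a * (δ / 2) := mul_le_mul_of_nonneg_left haf ha.le
    have : κ = a * (δ / 2) := by ring
    nlinarith
  exact le_of_mul_le_mul_left h4 ha

end SquareEnergy

/-! ### Absolute continuity with respect to one functional -/

section AbsoluteContinuity

variable {E : Type*} [AddCommGroup E] [Lattice E] [IsOrderedAddMonoid E] [Module ℝ E]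
  [IsOrderedModule ℝ E]
  {F : Type*} [NormedAddCommGroup F] [Lattice F] [HasSolidNorm F]
  [IsOrderedAddMonoid F] [NormedSpace ℝ F] [IsOrderedModule ℝ F]

theorem norm_le_norm_of_nonneg_of_le {x y : F} (hx : 0 ≤ x) (h : x ≤ y) : ‖x‖ ≤ ‖y‖ := by
  apply norm_le_norm_of_abs_le_abs
  rwa [abs_of_nonneg hx, abs_of_nonneg (hx.trans h)]

/-- A positive operator `M` admits positive functionals dominated by `‖M x‖` that attain it. -/
theorem exists_functional_apply_eq_norm {M : E →ₗ[ℝ] F} (hM : 0 ≤ M) {z : E} (hz : 0 ≤ z) :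
    ∃ g : E →ₗ[ℝ] ℝ, 0 ≤ g ∧ (∀ x, 0 ≤ x → g x ≤ ‖M x‖) ∧ g z = ‖M z‖ := by
  obtain ⟨g, hgz, hg⟩ := exists_linear_le_sublinear (fun x : E => ‖M x⁺‖)
    (fun c hc x => by
      simp only [posPart_smul_of_pos hc, map_smul, norm_smul, Real.norm_of_nonneg hc.le])
    (fun x y => by
      refine le_trans ?_ (norm_add_le _ _)
      rw [← map_add]
      exact norm_le_norm_of_nonneg_of_le (hM _ (posPart_nonneg _))
        (map_le_map_of_nonneg hM (posPart_add_le x y))) z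
  refine ⟨g, fun x hx => ?_, fun x hx => ?_, ?_⟩
  · have := hg (-x)
    rw [posPart_neg, negPart_eq_zero.2 hx, map_zero, map_neg, norm_zero] at this
    change 0 ≤ g x
    linarith
  · have := hg x
    rwa [posPart_of_nonneg hx] at this
  · rw [hgz, posPart_of_nonneg hz]

theorem partialSups_le_sum {x : ℕ → E} (hx : ∀ n, 0 ≤ x n) (n : ℕ) :
    partialSups x n ≤ ∑ i ∈ Finset.range (n + 1), x i :=
  partialSups_le _ _ _ fun _ hj => Finset.single_le_sum (f := x) (fun i _ => hx i)
    (Finset.mem_range.2 (Nat.lt_succ_of_le hj))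

/-- There is no sequence in `[0, s]` with norming functionals that are small on later terms, if
increasing sequences in `[0, s]` are mapped to Cauchy sequences. -/
theorem not_exists_almost_biorthogonal {M : E →ₗ[ℝ] F} {s : E}
    (hC : ∀ u : ℕ → E, Monotone u → (∀ n, u n ∈ Set.Icc 0 s) → CauchySeq fun n => M (u n))
    {ε : ℝ} (hε : 0 < ε) {x : ℕ → E} {g : ℕ → E →ₗ[ℝ] ℝ} (hx : ∀ n, x n ∈ Set.Icc 0 s)
    (hg : ∀ n, 0 ≤ g n) (hgM : ∀ n z, 0 ≤ z → g n z ≤ ‖M z‖)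
    (hgx : ∀ n, ε < g n (x n)) (hsmall : ∀ m k, m < k → g m (x k) ≤ (1 / 2 : ℝ) ^ k) : False := by
  set η : ℝ := ε / 4
  have hη : 0 < η := by positivity
  -- `W j N` is `x j ⊔ ... ⊔ x (j + N)`; its images under `M` are Cauchy in `N`.
  let W : ℕ → ℕ → E := fun j N => partialSups (fun i => x (j + i)) N
  have hWm : ∀ j, Monotone (W j) := fun j => partialSups_monotone _
  have hW : ∀ j N, W j N ∈ Set.Icc 0 s := fun j N =>
    ⟨(hx j).1.trans (le_partialSups_of_le (fun i => x (j + i)) (Nat.zero_le N)),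
      partialSups_le _ _ _ fun i _ => (hx _).2⟩
  have hN : ∀ j, ∃ N, ∀ n, N ≤ n → ‖M (W j n - W j N)‖ ≤ η * (1 / 2 : ℝ) ^ j := by
    intro j
    obtain ⟨N, hN⟩ := Metric.cauchySeq_iff'.1 (hC _ (hWm j) (hW j)) (η * (1 / 2 : ℝ) ^ j)
      (by positivity)
    refine ⟨N, fun n hn => ?_⟩
    rw [map_sub, ← dist_eq_norm]
    exact (hN n hn).le
  choose N hN using hN
  -- A decreasing substitute for the limit superior of `x`: `x m` exceeds `V m` only by small tails,
  -- yet `g m` is small on `V n` for large `n`.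
  let V : ℕ → E := fun n => Nat.rec (W 0 (N 0)) (fun n v => v ⊓ W (n + 1) (N (n + 1))) n
  have hVsucc : ∀ n, V (n + 1) = V n ⊓ W (n + 1) (N (n + 1)) := fun n => rfl
  have hVanti : Antitone V := antitone_nat_of_succ_le fun n => by
    rw [hVsucc]; exact inf_le_left
  have hVW : ∀ n, V n ≤ W n (N n) := by
    rintro (_ | n)
    · exact le_rfl
    · rw [hVsucc]; exact inf_le_right
  have hV : ∀ n, V n ∈ Set.Icc 0 s := by
    intro n
    refine ⟨?_, (hVW n).trans (hW _ _).2⟩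
    induction n with
    | zero => exact (hW _ _).1
    | succ n ih => rw [hVsucc]; exact le_inf ih (hW _ _).1
  have hcover : ∀ m n, n ≤ m →
      x m - V n ≤ ∑ j ∈ Finset.range (n + 1), (W j (N j + m) - W j (N j)) := by
    intro m n
    have hxW : ∀ j, j ≤ m → x m ≤ W j (N j + m) := by
      intro j hj
      have := le_partialSups_of_le (fun i => x (j + i)) (i := m - j) (j := N j + m) (by omega)
      rwa [Nat.add_sub_cancel' hj] at this
    have hpos : ∀ j, 0 ≤ W j (N j + m) - W j (N j) := fun j =>
      sub_nonneg.2 (hWm j (Nat.le_add_right _ _))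
    induction n with
    | zero =>
      intro h
      rw [Finset.sum_range_one]
      exact sub_le_sub_right (hxW 0 h) _
    | succ n ih =>
      intro h
      rw [Finset.sum_range_succ, hVsucc, sub_inf]
      refine sup_le ((ih (by omega)).trans (le_add_of_nonneg_right (hpos _))) ?_
      exact (sub_le_sub_right (hxW _ h) _).trans
        (le_add_of_nonneg_left (Finset.sum_nonneg fun j _ => hpos j))
  have hVC : CauchySeq fun n => M (s - V n) := by
    refine hC _ (fun i j h => sub_le_sub_left (hVanti h) s) fun n => ⟨sub_nonneg.2 (hV n).2, ?_⟩
    exact sub_le_self _ (hV n).1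
  obtain ⟨m, hm⟩ := Metric.cauchySeq_iff'.1 hVC η hη
  have h1 : g m (x m) ≤ g m (V m) + 2 * η := by
    have h2 := map_le_map_of_nonneg (hg m) (hcover m m le_rfl)
    rw [map_sub, map_sum] at h2
    have h3 : ∑ j ∈ Finset.range (m + 1), g m (W j (N j + m) - W j (N j)) ≤ 2 * η := by
      calc _ ≤ ∑ j ∈ Finset.range (m + 1), η * (1 / 2 : ℝ) ^ j := Finset.sum_le_sum fun j _ =>
            (hgM m _ (sub_nonneg.2 (hWm j (Nat.le_add_right _ _)))).trans
              (hN j _ (Nat.le_add_right _ _))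
        _ = η * ∑ j ∈ Finset.range (m + 1), (1 / 2 : ℝ) ^ j := by rw [Finset.mul_sum]
        _ ≤ η * 2 := mul_le_mul_of_nonneg_left (sum_geometric_two_le _) hη.le
        _ = 2 * η := mul_comm _ _
    linarith
  have h4 : ∀ n, m < n → g m (V m) ≤ η + 2 * (1 / 2 : ℝ) ^ n := by
    intro n hn
    have h5 : g m (V n) ≤ 2 * (1 / 2 : ℝ) ^ n := by
      calc g m (V n) ≤ g m (∑ i ∈ Finset.range (N n + 1), x (n + i)) :=
            map_le_map_of_nonneg (hg m) ((hVW n).trans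
              (partialSups_le_sum (x := fun i => x (n + i)) (fun i => (hx _).1) _))
        _ = ∑ i ∈ Finset.range (N n + 1), g m (x (n + i)) := map_sum _ _ _
        _ ≤ ∑ i ∈ Finset.range (N n + 1), (1 / 2 : ℝ) ^ n * (1 / 2 : ℝ) ^ i :=
            Finset.sum_le_sum fun i _ => by rw [← pow_add]; exact hsmall m _ (by omega)
        _ = (1 / 2 : ℝ) ^ n * ∑ i ∈ Finset.range (N n + 1), (1 / 2 : ℝ) ^ i := by
            rw [Finset.mul_sum]
        _ ≤ (1 / 2 : ℝ) ^ n * 2 :=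
            mul_le_mul_of_nonneg_left (sum_geometric_two_le _) (by positivity)
        _ = 2 * (1 / 2 : ℝ) ^ n := mul_comm _ _
    have h6 := hgM m (V m - V n) (sub_nonneg.2 (hVanti hn.le))
    have h7 := hm n hn.le
    rw [dist_eq_norm, ← map_sub, sub_sub_sub_cancel_left] at h7
    rw [map_sub] at h6
    linarith
  obtain ⟨n, hn⟩ := exists_pow_lt_of_lt_one (half_pos hη) (one_half_lt_one (α := ℝ))
  have h8 := h4 (max n (m + 1)) (by omega)
  have h9 : (1 / 2 : ℝ) ^ (max n (m + 1)) ≤ (1 / 2 : ℝ) ^ n :=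
    pow_le_pow_of_le_one (by norm_num) (by norm_num) (le_max_left _ _)
  have h10 := hgx m
  have h11 : ε = 4 * η := by ring
  linarith

/-- If increasing sequences in `[0, s]` are mapped to Cauchy sequences by a positive operator, then
its norm is absolutely continuous on `[0, s]` with respect to some positive functional, up to any
given error. -/
theorem exists_functional_absolutelyContinuous {M : E →ₗ[ℝ] F} (hM : 0 ≤ M) {s : E}
    (hC : ∀ u : ℕ → E, Monotone u → (∀ n, u n ∈ Set.Icc 0 s) → CauchySeq fun n => M (u n))
    {ε : ℝ} (hε : 0 < ε) :
    ∃ f : E →ₗ[ℝ] ℝ, 0 ≤ f ∧ ∃ δ : ℝ, 0 < δ ∧ ∀ x ∈ Set.Icc 0 s, f x ≤ δ → ‖M x‖ ≤ ε := by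
  by_contra! hcon
  choose X hX hXf hXM using hcon
  choose Y hY hYM hYz using fun (z : E) (hz : 0 ≤ z) => exists_functional_apply_eq_norm hM hz
  have hpow : ∀ n : ℕ, (0 : ℝ) < (1 / 2) ^ n := fun n => by positivity
  -- Each counterexample is chosen against the sum of all earlier norming functionals, so every one
  -- of them is small on it.
  let nxt : ℕ → {f : E →ₗ[ℝ] ℝ // 0 ≤ f} → {f : E →ₗ[ℝ] ℝ // 0 ≤ f} := fun n f =>
    ⟨f.1 + Y (X f.1 f.2 _ (hpow n)) (hX _ _ _ _).1, fun z hz =>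
      add_nonneg (f.2 z hz) (hY _ (hX _ _ _ _).1 z hz)⟩
  let G : ℕ → {f : E →ₗ[ℝ] ℝ // 0 ≤ f} := fun n =>
    Nat.rec ⟨0, le_refl (0 : E →ₗ[ℝ] ℝ)⟩ nxt n
  let x : ℕ → E := fun n => X (G n).1 (G n).2 _ (hpow n)
  have hx : ∀ n, x n ∈ Set.Icc 0 s := fun n => hX _ _ _ _
  let g : ℕ → E →ₗ[ℝ] ℝ := fun n => Y (x n) (hx n).1
  have hGsucc : ∀ n, (G (n + 1)).1 = (G n).1 + g n := fun n => rfl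
  have hGmono : ∀ z, 0 ≤ z → Monotone fun n => (G n).1 z := fun z hz =>
    monotone_nat_of_le_succ fun n => by
      rw [hGsucc]
      exact le_add_of_nonneg_right (hY _ _ z hz)
  refine not_exists_almost_biorthogonal hC hε hx (g := g) (fun n => hY _ _)
    (fun n z hz => hYM _ _ z hz) (fun n => ?_) (fun m k hmk => ?_)
  · change ε < Y (x n) (hx n).1 (x n)
    rw [hYz]
    exact hXM _ _ _ _
  · calc g m (x k) ≤ (G (m + 1)).1 (x k) := by
          rw [hGsucc]
          exact le_add_of_nonneg_left ((G m).2 _ (hx k).1)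
      _ ≤ (G k).1 (x k) := hGmono _ (hx k).1 hmk
      _ ≤ (1 / 2 : ℝ) ^ k := hXf _ _ _ _

end AbsoluteContinuity

/-! ### Weak convergence of ultrafilters -/

/-- In a regular space, the closure of a set is compact as soon as each ultrafilter on the set
converges. -/
theorem isCompact_closure_of_ultrafilter {X : Type*} [TopologicalSpace X] [RegularSpace X]
    {B : Set X} (h : ∀ U : Ultrafilter X, B ∈ U → ∃ x, (U : Filter X) ≤ 𝓝 x) :
    IsCompact (closure B) := by
  rw [isCompact_iff_ultrafilter_le_nhds']
  intro U hU
  -- The filter `U.bind 𝓝` moves `U` from the closure to nearby points of `B`; closed neighbourhoods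
  -- later carry the limit back to `U`.
  have hG : ((U : Filter X).bind 𝓝 ⊓ 𝓟 B).NeBot := by
    rw [inf_principal_neBot_iff]
    intro s hs
    obtain ⟨x, hx, hxB⟩ := U.nonempty_of_mem (inter_mem (mem_bind'.1 hs) hU)
    exact mem_closure_iff_nhds.1 hxB s hx
  have hWG := Ultrafilter.of_le ((U : Filter X).bind 𝓝 ⊓ 𝓟 B)
  have hWB : B ∈ Ultrafilter.of ((U : Filter X).bind 𝓝 ⊓ 𝓟 B) :=
    le_principal_iff.1 (hWG.trans inf_le_right)
  obtain ⟨x, hx⟩ := h _ hWB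
  refine ⟨x, mem_closure_iff_ultrafilter.2 ⟨_, hWB, hx⟩, ?_⟩
  rw [(closed_nhds_basis x).ge_iff]
  rintro N ⟨hN, hNc⟩
  by_contra hNU
  have h1 : Nᶜ ∈ (U : Filter X).bind 𝓝 :=
    mem_bind'.2 (mem_of_superset (Ultrafilter.compl_mem_iff_notMem.2 hNU)
      fun y hy => hNc.isOpen_compl.mem_nhds hy)
  exact Ultrafilter.compl_mem_iff_notMem.1 (hWG.trans inf_le_left h1) (hx hN)

theorem tendsto_toWeakSpace {F X : Type*} [NormedAddCommGroup F] [NormedSpace ℝ F] {l : Filter X}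
    {f : X → F} {y : F} (h : ∀ g : StrongDual ℝ F, Tendsto (fun x => g (f x)) l (𝓝 (g y))) :
    Tendsto (fun x => toWeakSpace ℝ F (f x)) l (𝓝 (toWeakSpace ℝ F y)) := by
  have hind : IsInducing fun (x : WeakSpace ℝ F) (g : StrongDual ℝ F) =>
      (topDualPairing ℝ F).flip x g := ⟨rfl⟩
  rw [hind.tendsto_nhds_iff, tendsto_pi_nhds]
  exact h

/-! ### Weak limits along ultrafilters on a solid sup-closed set -/

section Representation

variable {E : Type*} [AddCommGroup E] [Lattice E] [IsOrderedAddMonoid E] [Module ℝ E]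
  [IsOrderedModule ℝ E]
  {F : Type*} [NormedAddCommGroup F] [Lattice F] [HasSolidNorm F]
  [IsOrderedAddMonoid F] [NormedSpace ℝ F] [IsOrderedModule ℝ F]
  {M T : E →ₗ[ℝ] F} {S : Set E}

/-- Since `x - x ⊓ s = x ⊔ s - s`, failure would let one join elements forever with `M`-increments
above `ε`. -/
theorem exists_mem_norm_map_sub_inf_le (hS : SupClosed S) (hne : S.Nonempty)
    (hC : ∀ u : ℕ → E, Monotone u → (∀ n, u n ∈ S) → CauchySeq fun n => M (u n))
    {ε : ℝ} (hε : 0 < ε) : ∃ s ∈ S, ∀ x ∈ S, ‖M (x - x ⊓ s)‖ ≤ ε := by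
  by_contra! hcon
  choose X hXS hX using hcon
  obtain ⟨s₀, hs₀⟩ := hne
  let v : ℕ → S := fun n => Nat.rec ⟨s₀, hs₀⟩
    (fun _ s => ⟨X s.1 s.2 ⊔ s.1, hS (hXS s.1 s.2) s.2⟩) n
  have hv : ∀ n, (v (n + 1)).1 = X (v n).1 (v n).2 ⊔ (v n).1 := fun n => rfl
  have hmono : Monotone fun n => (v n).1 := monotone_nat_of_le_succ fun n => by
    rw [hv]; exact le_sup_right
  obtain ⟨N, hN⟩ := Metric.cauchySeq_iff'.1 (hC _ hmono fun n => (v n).2) ε hε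
  have h1 := hN (N + 1) (Nat.le_succ N)
  rw [dist_eq_norm, ← map_sub, hv] at h1
  have h2 := hX (v N).1 (v N).2
  have h3 : ∀ a b : E, a - a ⊓ b = a ⊔ b - b := fun a b => by
    rw [sub_eq_sub_iff_add_eq_add, add_comm (a ⊔ b), inf_add_sup]
  rw [h3] at h2
  exact lt_asymm h1 h2

theorem exists_tendsto_of_ultrafilter_abs_le {X : Type*} (U : Ultrafilter X) {h : X → ℝ}
    {B : ℝ} (hB : ∀ᶠ x in U, |h x| ≤ B) : ∃ L, Tendsto h U (𝓝 L) := by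
  obtain ⟨L, -, hL⟩ := (isCompact_Icc (a := -B) (b := B)).ultrafilter_le_nhds (U.map h)
    (le_principal_iff.2 (hB.mono fun x hx => abs_le.1 hx : ∀ᶠ x in U, h x ∈ Set.Icc (-B) B))
  exact ⟨L, hL⟩

/-- Approximate representing vectors of an ultrafilter living on `S`. -/
theorem exists_approx_representation (hM : 0 ≤ M) (hT : ∀ x, ‖T x‖ ≤ ‖M |x|‖)
    (hpos : ∀ x ∈ S, 0 ≤ x) (hsolid : ∀ x ∈ S, ∀ y, 0 ≤ y → y ≤ x → y ∈ S) (hS : SupClosed S)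
    (hC : ∀ u : ℕ → E, Monotone u → (∀ n, u n ∈ S) → CauchySeq fun n => M (u n))
    {V : Ultrafilter E} {p : E → E} (hp : ∀ᶠ x in V, p x ∈ S) {ε : ℝ} (hε : 0 < ε) :
    ∃ y : F, ∀ (g : StrongDual ℝ F) (η : ℝ), 0 < η →
      ∀ᶠ x in V, |g (T (p x)) - g y| ≤ ‖g‖ * ε + η := by
  have hne : S.Nonempty := let ⟨x, hx⟩ := V.nonempty_of_mem hp; ⟨p x, hx⟩
  obtain ⟨s, hsS, hs⟩ := exists_mem_norm_map_sub_inf_le hS hne hC (half_pos hε)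
  let U : Ultrafilter E := V.map fun x => p x ⊓ s
  have hU : Set.Icc 0 s ∈ (U : Filter E) := by
    change ∀ᶠ x in V, p x ⊓ s ∈ Set.Icc 0 s
    filter_upwards [hp] with x hx
    exact ⟨le_inf (hpos _ hx) (hpos _ hsS), inf_le_right⟩
  obtain ⟨f, hf, δ, hδ, hfδ⟩ := exists_functional_absolutelyContinuous hM (s := s)
    (fun u hu hus => hC u hu fun n => hsolid s hsS _ (hus n).1 (hus n).2) (half_pos hε)
  obtain ⟨y₀, hy₀, hy₀D⟩ := exists_forall_convex_mem_apply_abs_sub_le hf (U : Filter E) hU hδ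
  have hgT : ∀ (g : StrongDual ℝ F) (x y : E) (r : ℝ), ‖M |x - y|‖ ≤ r →
      |g (T x) - g (T y)| ≤ ‖g‖ * r := fun g x y r h => by
    rw [← map_sub, ← map_sub, ← Real.norm_eq_abs]
    exact (g.le_opNorm _).trans (mul_le_mul_of_nonneg_left ((hT _).trans h) (norm_nonneg _))
  refine ⟨T y₀, fun g η hη => ?_⟩
  obtain ⟨L, hL⟩ := exists_tendsto_of_ultrafilter_abs_le U (h := fun x => g (T x))
    (B := ‖g‖ * ‖M s‖) (by
      filter_upwards [hU] with x hx
      have := hgT g x 0 ‖M s‖ (by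
        rw [sub_zero, abs_of_nonneg hx.1]
        exact norm_le_norm_of_nonneg_of_le (hM _ hx.1) (map_le_map_of_nonneg hM hx.2))
      simpa using this)
  -- This slab is convex, so it contains a point `f`-close to `y₀`, although `y₀` was fixed before
  -- `g`.
  have hDU : (fun x => g (T x)) ⁻¹' Metric.closedBall L (η / 2) ∈ (U : Filter E) :=
    hL (Metric.closedBall_mem_nhds L (half_pos hη))
  have hDc : Convex ℝ ((fun x => g (T x)) ⁻¹' Metric.closedBall L (η / 2)) :=
    (convex_closedBall L (η / 2)).linear_preimage (g.toLinearMap ∘ₗ T)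
  obtain ⟨y₁, ⟨hy₁D, hy₁⟩, hy₁f⟩ := hy₀D _ hDU hDc
  have h1 : |g (T y₀) - g (T y₁)| ≤ ‖g‖ * (ε / 2) := by
    refine hgT g _ _ _ (hfδ _ ⟨abs_nonneg _, ?_⟩ hy₁f)
    rw [abs_le', neg_sub]
    exact ⟨(sub_le_self _ hy₁.1).trans hy₀.2, (sub_le_self _ hy₀.1).trans hy₁.2⟩
  have h2 : |g (T y₁) - L| ≤ η / 2 := hy₁D
  have h3 : ∀ᶠ x in V, |g (T (p x ⊓ s)) - L| ≤ η / 2 := hDU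
  filter_upwards [hp, h3] with x hx hx3
  have h4 : |g (T (p x)) - g (T (p x ⊓ s))| ≤ ‖g‖ * (ε / 2) := by
    refine hgT g _ _ _ ?_
    rw [abs_of_nonneg (sub_nonneg.2 inf_le_left)]
    exact hs _ hx
  rw [abs_le] at *
  constructor <;> linarith [h1.1, h1.2, h2.1, h2.2, hx3.1, hx3.2, h4.1, h4.2]

/-- Approximate representing vectors with errors `2⁻ⁿ` form a Cauchy sequence: a norming functional
compares two of them through a common `T (p x)`. -/
theorem exists_representation [CompleteSpace F] (hM : 0 ≤ M) (hT : ∀ x, ‖T x‖ ≤ ‖M |x|‖)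
    (hpos : ∀ x ∈ S, 0 ≤ x) (hsolid : ∀ x ∈ S, ∀ y, 0 ≤ y → y ≤ x → y ∈ S) (hS : SupClosed S)
    (hC : ∀ u : ℕ → E, Monotone u → (∀ n, u n ∈ S) → CauchySeq fun n => M (u n))
    {V : Ultrafilter E} {p : E → E} (hp : ∀ᶠ x in V, p x ∈ S) :
    ∃ y : F, ∀ g : StrongDual ℝ F, Tendsto (fun x => g (T (p x))) V (𝓝 (g y)) := by
  have hpow : ∀ n : ℕ, (0 : ℝ) < (1 / 2) ^ n := fun n => by positivity
  choose y hy using fun n => exists_approx_representation hM hT hpos hsolid hS hC hp (hpow n)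
  have hyy : ∀ n m, ‖y n - y m‖ ≤ (1 / 2 : ℝ) ^ n + (1 / 2 : ℝ) ^ m := by
    intro n m
    obtain ⟨g, hg1, hg⟩ := exists_dual_vector'' ℝ (y n - y m)
    refine le_of_forall_pos_le_add fun η hη => ?_
    obtain ⟨x, hxn, hxm⟩ := ((hy n g (η / 2) (half_pos hη)).and
      (hy m g (η / 2) (half_pos hη))).exists
    rw [abs_le] at hxn hxm
    have h1 : g (y n) - g (y m) = ‖y n - y m‖ := by rw [← map_sub, hg]; rfl
    have h2 : ‖g‖ * (1 / 2 : ℝ) ^ n ≤ (1 / 2 : ℝ) ^ n :=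
      mul_le_of_le_one_left (hpow n).le hg1
    have h3 : ‖g‖ * (1 / 2 : ℝ) ^ m ≤ (1 / 2 : ℝ) ^ m :=
      mul_le_of_le_one_left (hpow m).le hg1
    linarith [hxn.1, hxm.2]
  have hlim : Tendsto (fun n : ℕ => (1 / 2 : ℝ) ^ n) atTop (𝓝 0) :=
    tendsto_pow_atTop_nhds_zero_of_lt_one (by norm_num) (by norm_num)
  have hcau : CauchySeq y := by
    refine cauchySeq_of_le_tendsto_0 (fun n => (1 / 2 : ℝ) ^ n + (1 / 2 : ℝ) ^ n) ?_
      (by simpa using hlim.add hlim)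
    intro n m N hn hm
    rw [dist_eq_norm]
    refine (hyy n m).trans (add_le_add ?_ ?_) <;>
      exact pow_le_pow_of_le_one (by norm_num) (by norm_num) (by assumption)
  obtain ⟨z, hz⟩ := cauchySeq_tendsto_of_complete hcau
  refine ⟨z, fun g => ?_⟩
  rw [Metric.tendsto_nhds]
  intro r hr
  have h1 : Tendsto (fun n => ‖g‖ * (1 / 2 : ℝ) ^ n) atTop (𝓝 0) := by
    simpa using hlim.const_mul ‖g‖
  have h2 : Tendsto (fun n => g (y n)) atTop (𝓝 (g z)) := (g.continuous.tendsto z).comp hz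
  obtain ⟨n, hn1, hn2⟩ := ((h1.eventually (gt_mem_nhds (show 0 < r / 3 by positivity))).and
    (Metric.tendsto_nhds.1 h2 (r / 3) (by positivity))).exists
  filter_upwards [hy n g (r / 3) (by positivity)] with x hx
  rw [Real.dist_eq, abs_lt] at *
  rw [abs_le] at hx
  constructor <;> linarith [hx.1, hx.2, hn2.1, hn2.2]

end Representation

/-! ### b-order bounded sets and the reduction -/

section BOrderBounded

variable {E : Type*} [AddCommGroup E] [Lattice E] [IsOrderedAddMonoid E] [Module ℝ E]
  [IsOrderedModule ℝ E]

/-- A positive functional as an element of the order dual. -/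
def OrderBoundedDual.ofNonneg {f : E →ₗ[ℝ] ℝ} (hf : 0 ≤ f) : OrderBoundedDual E :=
  ⟨f, isOrderBoundedOp_of_nonneg hf⟩

/-- The positive elements of `E` lying below the positive part of `Ψ` in the bidual. -/
def belowBidual (Ψ : OrderBoundedBidual E) : Set E :=
  {x | 0 ≤ x ∧ ∀ f : OrderBoundedDual E, 0 ≤ f → f.1 x ≤ sSup (Ψ.1 '' Set.Icc 0 f)}

variable {Ψ : OrderBoundedBidual E}

theorem le_sSup_image_Icc (Ψ : OrderBoundedBidual E) {f g : OrderBoundedDual E} (hg : 0 ≤ g)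
    (hgf : g ≤ f) : Ψ.1 g ≤ sSup (Ψ.1 '' Set.Icc 0 f) :=
  le_csSup (Ψ.2 _ ⟨⟨0, fun _ h => h.1⟩, ⟨f, fun _ h => h.2⟩⟩).2 ⟨g, ⟨hg, hgf⟩, rfl⟩

/-- Superadditivity is the only half of the additivity of `Ψ⁺` needed for closure under suprema. -/
theorem sSup_image_Icc_add_le {f₁ f₂ : OrderBoundedDual E} (h₁ : 0 ≤ f₁) (h₂ : 0 ≤ f₂) :
    sSup (Ψ.1 '' Set.Icc 0 f₁) + sSup (Ψ.1 '' Set.Icc 0 f₂) ≤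
      sSup (Ψ.1 '' Set.Icc 0 (f₁ + f₂)) := by
  rw [← le_sub_iff_add_le]
  refine csSup_le ⟨_, 0, ⟨le_rfl, h₁⟩, rfl⟩ ?_
  rintro _ ⟨g₁, hg₁, rfl⟩
  rw [le_sub_comm]
  refine csSup_le ⟨_, 0, ⟨le_rfl, h₂⟩, rfl⟩ ?_
  rintro _ ⟨g₂, hg₂, rfl⟩
  rw [le_sub_iff_add_le', ← map_add]
  exact le_sSup_image_Icc Ψ (fun x hx => add_nonneg (hg₁.1 x hx) (hg₂.1 x hx))
    (fun x hx => add_le_add (hg₁.2 x hx) (hg₂.2 x hx))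

theorem belowBidual_solid {x y : E} (hx : x ∈ belowBidual Ψ) (hy : 0 ≤ y) (hyx : y ≤ x) :
    y ∈ belowBidual Ψ :=
  ⟨hy, fun f hf => (map_le_map_of_nonneg (f := f.1) hf hyx).trans (hx.2 f hf)⟩

/-- Split `f` as `g + (f - g)` with `g (x - y) = f (x - y)⁺`; then `f (x ⊔ y) = g x + (f - g) y`. -/
theorem supClosed_belowBidual : SupClosed (belowBidual Ψ) := by
  intro x hx y hy
  refine ⟨hx.1.trans le_sup_left, fun f hf => ?_⟩
  obtain ⟨g, hg, hgf, hgz⟩ := exists_functional_apply_eq_posPart (f := f.1) hf (x - y)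
  have hfg : 0 ≤ f.1 - g := fun z hz => sub_nonneg.2 (hgf z hz)
  have h1 := hx.2 (OrderBoundedDual.ofNonneg hg) hg
  have h2 := hy.2 (OrderBoundedDual.ofNonneg hfg) hfg
  have h3 := sSup_image_Icc_add_le (Ψ := Ψ) (f₁ := OrderBoundedDual.ofNonneg hg)
    (f₂ := OrderBoundedDual.ofNonneg hfg) hg hfg
  have h4 : OrderBoundedDual.ofNonneg hg + OrderBoundedDual.ofNonneg hfg = f :=
    Subtype.ext (add_sub_cancel g f.1)
  rw [h4] at h3
  refine le_trans (le_of_eq ?_) ((add_le_add h1 h2).trans h3)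
  change f.1 (x ⊔ y) = g x + (f.1 y - g y)
  rw [sup_eq_add_posPart_sub, map_add, ← hgz, map_sub]
  ring

theorem posPart_mem_belowBidual {x : E} (hx : toOrderBidual x ≤ Ψ) : x⁺ ∈ belowBidual Ψ := by
  refine ⟨posPart_nonneg x, fun f hf => ?_⟩
  obtain ⟨g, hg, hgf, hgx⟩ := exists_functional_apply_eq_posPart (f := f.1) hf x
  rw [← hgx]
  exact (hx (OrderBoundedDual.ofNonneg hg) hg).trans (le_sSup_image_Icc Ψ hg hgf)

theorem negPart_mem_belowBidual {x : E} (hx : Ψ ≤ toOrderBidual x) :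
    x⁻ ∈ belowBidual (-Ψ) := by
  rw [← posPart_neg]
  refine posPart_mem_belowBidual fun f hf => ?_
  change f.1 (-x) ≤ -Ψ.1 f
  rw [map_neg]
  exact neg_le_neg (hx f hf)

theorem exists_tendsto_of_monotone_belowBidual {u : ℕ → E} (hu : Monotone u)
    (huS : ∀ n, u n ∈ belowBidual Ψ) (f : OrderBoundedDual E) :
    ∃ L, Tendsto (fun n => f.1 (u n)) atTop (𝓝 L) := by
  have hpos : ∀ h : E →ₗ[ℝ] ℝ, 0 ≤ h → ∃ L, Tendsto (fun n => h (u n)) atTop (𝓝 L) :=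
    fun h hh => ⟨_, tendsto_atTop_ciSup (fun i j hij => map_le_map_of_nonneg hh (hu hij))
      ⟨sSup (Ψ.1 '' Set.Icc 0 (OrderBoundedDual.ofNonneg hh)), by
        rintro _ ⟨n, rfl⟩
        exact (huS n).2 (OrderBoundedDual.ofNonneg hh) hh⟩⟩
  obtain ⟨g, hg, hfg⟩ := exists_nonneg_functional_ge f.2
  obtain ⟨L₁, h₁⟩ := hpos g hg
  obtain ⟨L₂, h₂⟩ := hpos (g - f.1) fun z hz => sub_nonneg.2 (hfg z hz)
  refine ⟨L₁ - L₂, (h₁.sub h₂).congr fun n => ?_⟩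
  rw [LinearMap.sub_apply, sub_sub_cancel]

/-- The upper bound is the pointwise limit `f ↦ lim f (u n)`, whose linearity is immediate. -/
theorem isBOrderBounded_range_of_monotone {u : ℕ → E} (hu : Monotone u)
    (huS : ∀ n, u n ∈ belowBidual Ψ) : IsBOrderBounded (Set.range u) := by
  choose ℓ hℓ using exists_tendsto_of_monotone_belowBidual hu huS
  let Λ : OrderBoundedDual E →ₗ[ℝ] ℝ :=
    { toFun := ℓ
      map_add' := fun f g => tendsto_nhds_unique (hℓ (f + g)) ((hℓ f).add (hℓ g))
      map_smul' := fun c f => tendsto_nhds_unique (hℓ (c • f)) ((hℓ f).const_mul c) }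
  have hmono : ∀ f g, f ≤ g → Λ f ≤ Λ g := fun f g h =>
    le_of_tendsto_of_tendsto' (hℓ f) (hℓ g) fun n => h _ (huS n).1
  have hΛ : IsOrderBoundedOp Λ := by
    rintro A ⟨⟨l, hl⟩, ⟨v, hv⟩⟩
    refine ⟨⟨Λ l, ?_⟩, ⟨Λ v, ?_⟩⟩
    · rintro _ ⟨f, hf, rfl⟩
      exact hmono _ _ (hl hf)
    · rintro _ ⟨f, hf, rfl⟩
      exact hmono _ _ (hv hf)
  refine ⟨⟨0, ?_⟩, ⟨⟨Λ, hΛ⟩, ?_⟩⟩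
  · rintro _ ⟨_, ⟨n, rfl⟩, rfl⟩ f hf
    exact hf _ (huS n).1
  · rintro _ ⟨_, ⟨n, rfl⟩, rfl⟩ f hf
    exact Monotone.ge_of_tendsto (f := fun n => f.1 (u n))
      (fun i j hij => map_le_map_of_nonneg (f := f.1) hf (hu hij)) (hℓ f) n

/-- An operator dominated by a positive operator that maps b-order bounded increasing sequences to
Cauchy sequences is b-weakly compact. -/
theorem isBWeaklyCompact_of_dominated
    {F : Type*} [NormedAddCommGroup F] [Lattice F] [HasSolidNorm F]
    [IsOrderedAddMonoid F] [NormedSpace ℝ F] [IsOrderedModule ℝ F] [CompleteSpace F]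
    {M T : E →ₗ[ℝ] F} (hM : 0 ≤ M) (hT : ∀ x, ‖T x‖ ≤ ‖M |x|‖)
    (hC : ∀ u : ℕ → E, Monotone u → (∀ n, 0 ≤ u n) → IsBOrderBounded (Set.range u) →
      CauchySeq fun n => M (u n)) : IsBWeaklyCompact T := by
  have hrep : ∀ (Ψ : OrderBoundedBidual E) (V : Ultrafilter E) (p : E → E),
      (∀ᶠ x in V, p x ∈ belowBidual Ψ) →
      ∃ y : F, ∀ g : StrongDual ℝ F, Tendsto (fun x => g (T (p x))) V (𝓝 (g y)) :=
    fun Ψ V p hp => exists_representation hM hT (fun x hx => hx.1)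
      (fun x hx y hy hyx => belowBidual_solid hx hy hyx) supClosed_belowBidual
      (fun u hu huS => hC u hu (fun n => (huS n).1) (isBOrderBounded_range_of_monotone hu huS)) hp
  rintro A ⟨⟨φ, hφ⟩, ⟨ψ, hψ⟩⟩
  rw [← Set.image_comp]
  refine isCompact_closure_of_ultrafilter fun U hU => ?_
  -- Lifting the ultrafilter to `A` allows positive and negative parts to be treated separately.
  let V : Ultrafilter E := Ultrafilter.ofComapInfPrincipal hU
  have hVU : V.map (toWeakSpace ℝ F ∘ T) = U := Ultrafilter.ofComapInfPrincipal_eq_of_map hU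
  have hVA : ∀ᶠ x in V, x ∈ A := Ultrafilter.ofComapInfPrincipal_mem hU
  obtain ⟨y₁, hy₁⟩ := hrep ψ V (·⁺) (hVA.mono fun x hx => posPart_mem_belowBidual (hψ ⟨x, hx, rfl⟩))
  obtain ⟨y₂, hy₂⟩ := hrep (-φ) V (·⁻)
    (hVA.mono fun x hx => negPart_mem_belowBidual (hφ ⟨x, hx, rfl⟩))
  refine ⟨toWeakSpace ℝ F (y₁ - y₂), ?_⟩
  rw [← hVU]
  refine tendsto_toWeakSpace fun g => ?_
  have := (hy₁ g).sub (hy₂ g)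
  have h : ∀ x, g (T x⁺) - g (T x⁻) = g (T x) := fun x => by
    rw [← map_sub, ← map_sub, posPart_sub_negPart]
  simp only [h, ← map_sub] at this
  exact this

end BOrderBounded

/-! ### Dedekind completeness of KB-spaces -/

section KBSpace

variable {F : Type*} [NormedAddCommGroup F] [Lattice F] [HasSolidNorm F]
  [IsOrderedAddMonoid F] [NormedSpace ℝ F] [IsOrderedModule ℝ F]

/-- A nonempty set closed under suprema whose increasing sequences converge has a least upper
bound. -/
theorem exists_isLUB_of_supClosed {D : Set F} (hD : SupClosed D) (hne : D.Nonempty)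
    (hC : ∀ u : ℕ → F, Monotone u → (∀ n, u n ∈ D) → ∃ y, Tendsto u atTop (𝓝 y)) :
    ∃ y, IsLUB D y := by
  -- Otherwise repeated joins above `d₀` give an increasing sequence with steps larger than `ε`.
  have hstep : ∀ ε : ℝ, 0 < ε → ∀ d₀ ∈ D, ∃ d ∈ D, d₀ ≤ d ∧ ∀ e ∈ D, ‖e ⊔ d - d‖ ≤ ε := by
    intro ε hε d₀ hd₀
    by_contra! hcon
    choose X hXD hX using hcon
    let v : ℕ → {d // d ∈ D ∧ d₀ ≤ d} := fun n => Nat.rec ⟨d₀, hd₀, le_rfl⟩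
      (fun _ d => ⟨X d.1 d.2.1 d.2.2 ⊔ d.1, hD (hXD _ _ _) d.2.1, d.2.2.trans le_sup_right⟩) n
    have hv : ∀ n, (v (n + 1)).1 = X (v n).1 (v n).2.1 (v n).2.2 ⊔ (v n).1 := fun n => rfl
    obtain ⟨y, hy⟩ := hC (fun n => (v n).1)
      (monotone_nat_of_le_succ fun n => by rw [hv]; exact le_sup_right) fun n => (v n).2.1
    obtain ⟨N, hN⟩ := Metric.cauchySeq_iff'.1 hy.cauchySeq ε hε
    have h1 := hN (N + 1) (Nat.le_succ N)
    rw [dist_eq_norm, hv] at h1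
    exact lt_asymm h1 (hX _ (v N).2.1 (v N).2.2)
  have hpow : ∀ n : ℕ, (0 : ℝ) < (1 / 2) ^ n := fun n => by positivity
  choose X hXD hXle hX using hstep
  obtain ⟨d₀, hd₀⟩ := hne
  let v : ℕ → D := fun n => Nat.rec ⟨d₀, hd₀⟩
    (fun n d => ⟨X _ (hpow n) d.1 d.2, hXD _ _ _ _⟩) n
  have hmono : Monotone fun n => (v n).1 := monotone_nat_of_le_succ fun n => hXle _ _ _ _
  obtain ⟨y, hy⟩ := hC _ hmono fun n => (v n).2
  refine ⟨y, fun e he => ?_, fun z hz => le_of_tendsto' hy fun n => hz (v n).2⟩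
  have hlim : Tendsto (fun n : ℕ => (1 / 2 : ℝ) ^ n) atTop (𝓝 0) :=
    tendsto_pow_atTop_nhds_zero_of_lt_one (by norm_num) (by norm_num)
  have h1 : Tendsto (fun n => e ⊔ (v (n + 1)).1 - (v (n + 1)).1) atTop (𝓝 0) :=
    squeeze_zero_norm (fun n => hX _ (hpow n) _ (v n).2 e he) hlim
  have h2 := h1.add (hy.comp (tendsto_add_atTop_nat 1))
  rw [zero_add] at h2
  refine ge_of_tendsto' h2 fun n => ?_
  change e ≤ e ⊔ (v (n + 1)).1 - (v (n + 1)).1 + (v (n + 1)).1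
  rw [sub_add_cancel]
  exact le_sup_left

/-- A KB-space is Dedekind complete. -/
theorem IsKBSpace.exists_isLUB [CompleteSpace F] (hF : IsKBSpace F) (B : Set F)
    (hne : B.Nonempty) (hB : BddAbove B) : ∃ y, IsLUB B y := by
  obtain ⟨b, hb⟩ := hne
  obtain ⟨c, hc⟩ := hB
  have hc' : ∀ x ∈ supClosure B, x ≤ c := by
    rw [← upperBounds_supClosure] at hc
    exact hc
  -- Staying above `b` makes the sequences positive after subtracting `b`, without changing the
  -- upper bounds.
  obtain ⟨y, hy⟩ := exists_isLUB_of_supClosed (D := supClosure B ∩ Set.Ici b)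
    (supClosed_supClosure.inter fun x hx y _ => hx.trans le_sup_left)
    ⟨b, subset_supClosure hb, le_rfl⟩ (fun u hu huD => by
      obtain ⟨y, hy⟩ := hF (fun n => u n - b) (fun i j h => sub_le_sub_right (hu h) b)
        (fun n => sub_nonneg.2 (huD n).2) ⟨‖c - b‖, fun n =>
          norm_le_norm_of_nonneg_of_le (sub_nonneg.2 (huD n).2)
            (sub_le_sub_right (hc' _ (huD n).1) b)⟩
      exact ⟨y + b, by simpa using hy.add_const b⟩)
  refine ⟨y, fun x hx => ?_, fun z hz => hy.2 fun x hx => ?_⟩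
  · exact le_sup_left.trans (hy.1 ⟨supClosed_supClosure (subset_supClosure hx)
      (subset_supClosure hb), le_sup_right⟩)
  · rw [← upperBounds_supClosure] at hz
    exact hz hx.1

end KBSpace

/-! ### Increasing sequences with Cauchy images -/

section Main

variable {E F : Type*} [AddCommGroup E] [Lattice E] [IsOrderedAddMonoid E] [Module ℝ E]
  [IsOrderedModule ℝ E]
  [NormedAddCommGroup F] [Lattice F] [HasSolidNorm F]
  [IsOrderedAddMonoid F] [NormedSpace ℝ F] [IsOrderedModule ℝ F]
  {M : E →ₗ[ℝ] F}

theorem isOrderBoundedOp_of_continuous (g : StrongDual ℝ F) :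
    IsOrderBoundedOp (g : F →ₗ[ℝ] ℝ) := by
  rintro A ⟨⟨l, hl⟩, ⟨u, hu⟩⟩
  refine isOrderBounded_image_real_iff.2 ⟨‖g‖ * (‖l‖ + ‖u - l‖), fun x hx => ?_⟩
  rw [← Real.norm_eq_abs]
  refine (g.le_opNorm x).trans (mul_le_mul_of_nonneg_left ?_ (norm_nonneg g))
  calc ‖x‖ = ‖l + (x - l)‖ := by rw [add_sub_cancel]
    _ ≤ ‖l‖ + ‖x - l‖ := norm_add_le _ _
    _ ≤ ‖l‖ + ‖u - l‖ := add_le_add_right (norm_le_norm_of_nonneg_of_le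
        (sub_nonneg.2 (hl hx)) (sub_le_sub_right (hu hx) l)) _

/-- A positive operator maps b-order bounded sets of positive elements to norm bounded sets. -/
theorem exists_norm_map_le_of_isBOrderBounded (hM : 0 ≤ M) {A : Set E} (hA : ∀ x ∈ A, 0 ≤ x)
    (hAb : IsBOrderBounded A) : ∃ C : ℝ, ∀ x ∈ A, ‖M x‖ ≤ C := by
  obtain ⟨-, ⟨ψ, hψ⟩⟩ := hAb
  have hpt : ∀ g : StrongDual ℝ F, ∃ C, ∀ x : A,
      ‖NormedSpace.inclusionInDoubleDual ℝ F (M x.1) g‖ ≤ C := by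
    intro g
    obtain ⟨h₁, hh₁, hgh₁⟩ := exists_nonneg_functional_ge (isOrderBoundedOp_of_continuous g)
    obtain ⟨h₂, hh₂, hgh₂⟩ := exists_nonneg_functional_ge (isOrderBoundedOp_of_continuous (-g))
    -- The bound is `ψ` evaluated at the positive functional `h ∘ₗ M`.
    have hle : ∀ h : F →ₗ[ℝ] ℝ, 0 ≤ h → ∃ C, ∀ x : A, h (M x.1) ≤ C := fun h hh => by
      have hhM : 0 ≤ h ∘ₗ M := fun x hx => hh _ (hM x hx)
      exact ⟨ψ.1 (OrderBoundedDual.ofNonneg hhM),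
        fun x => hψ ⟨x.1, x.2, rfl⟩ (OrderBoundedDual.ofNonneg hhM) hhM⟩
    obtain ⟨C₁, hC₁⟩ := hle h₁ hh₁
    obtain ⟨C₂, hC₂⟩ := hle h₂ hh₂
    refine ⟨max C₁ C₂, fun x => ?_⟩
    rw [NormedSpace.dual_def, Real.norm_eq_abs, abs_le']
    exact ⟨(hgh₁ _ (hM _ (hA _ x.2))).trans ((hC₁ x).trans (le_max_left _ _)),
      (hgh₂ _ (hM _ (hA _ x.2))).trans ((hC₂ x).trans (le_max_right _ _))⟩
  obtain ⟨C, hC⟩ := banach_steinhaus hpt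
  refine ⟨C, fun x hx => ?_⟩
  rw [← (NormedSpace.inclusionInDoubleDualLi ℝ (E := F)).norm_map]
  exact hC ⟨x, hx⟩

theorem IsKBSpace.cauchySeq_map [CompleteSpace F] (hF : IsKBSpace F) (hM : 0 ≤ M) {u : ℕ → E}
    (hu : Monotone u) (hu0 : ∀ n, 0 ≤ u n) (hub : IsBOrderBounded (Set.range u)) :
    CauchySeq fun n => M (u n) := by
  obtain ⟨C, hC⟩ := exists_norm_map_le_of_isBOrderBounded hM (by rintro _ ⟨n, rfl⟩; exact hu0 n) hub
  obtain ⟨y, hy⟩ := hF (fun n => M (u n)) (fun i j h => map_le_map_of_nonneg hM (hu h))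
    (fun n => hM _ (hu0 n)) ⟨C, fun n => hC _ ⟨n, rfl⟩⟩
  exact hy.cauchySeq

/-- Mazur's theorem. -/
theorem toWeakSpace_mem_closure_iff {s : Set F} (hs : Convex ℝ s) {y : F} :
    toWeakSpace ℝ F y ∈ closure (toWeakSpace ℝ F '' s) ↔ y ∈ closure s := by
  rw [← hs.toWeakSpace_closure ℝ]
  exact (toWeakSpace ℝ F).injective.mem_set_image

/-- An increasing sequence with relatively weakly compact range is a Cauchy sequence. -/
theorem cauchySeq_of_monotone_of_isCompact_weak {u : ℕ → F} (hu : Monotone u)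
    (hK : IsCompact (closure (toWeakSpace ℝ F '' Set.range u))) : CauchySeq u := by
  have hmemK : ∀ n, toWeakSpace ℝ F (u n) ∈ closure (toWeakSpace ℝ F '' Set.range u) :=
    fun n => subset_closure ⟨u n, ⟨n, rfl⟩, rfl⟩
  obtain ⟨y', -, hy'⟩ := hK.exists_mapClusterPt_of_frequently (l := atTop)
    (Eventually.of_forall hmemK).frequently
  obtain ⟨y, rfl⟩ := (toWeakSpace ℝ F).surjective y'
  have hmem : ∀ s : Set F, Convex ℝ s → (∀ᶠ n in atTop, u n ∈ s) → y ∈ closure s := by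
    intro s hs h
    rw [← toWeakSpace_mem_closure_iff hs]
    refine mem_closure_iff_clusterPt.2 (ClusterPt.mono hy' (le_principal_iff.2 ?_))
    exact mem_map.2 (h.mono fun n hn => ⟨_, hn, rfl⟩)
  have hle : ∀ n, u n ≤ y := fun n => by
    have := hmem (Set.Ici (u n)) (convex_Ici _) ((eventually_ge_atTop n).mono fun m hm => hu hm)
    rwa [isClosed_Ici.closure_eq] at this
  -- The weak cluster point `y` is in the norm closure of this set; if `z ≤ u N` is near `y`, then
  -- `z ≤ u n ≤ y` for `n ≥ N` traps the tail.
  have hdown : Convex ℝ {z : F | ∃ n, z ≤ u n} := by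
    rintro z ⟨n, hn⟩ w ⟨m, hm⟩ a b ha hb hab
    refine ⟨max n m, (convex_Iic (u (max n m))) ?_ ?_ ha hb hab⟩
    · exact hn.trans (hu (le_max_left _ _))
    · exact hm.trans (hu (le_max_right _ _))
  have hy := hmem _ hdown (Eventually.of_forall fun n => ⟨n, le_rfl⟩)
  refine Tendsto.cauchySeq (x := y) (Metric.tendsto_atTop.2 fun ε hε => ?_)
  obtain ⟨z, ⟨N, hN⟩, hz⟩ := Metric.mem_closure_iff.1 hy ε hε
  refine ⟨N, fun n hn => lt_of_le_of_lt ?_ hz⟩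
  rw [dist_comm, dist_eq_norm, dist_eq_norm]
  exact norm_le_norm_of_nonneg_of_le (sub_nonneg.2 (hle n))
    (sub_le_sub_left (hN.trans (hu hn)) y)

theorem IsBWeaklyCompact.cauchySeq_map (hMc : IsBWeaklyCompact M) (hM : 0 ≤ M) {u : ℕ → E}
    (hu : Monotone u) (hub : IsBOrderBounded (Set.range u)) : CauchySeq fun n => M (u n) := by
  refine cauchySeq_of_monotone_of_isCompact_weak (fun i j h => map_le_map_of_nonneg hM (hu h)) ?_
  have := hMc _ hub
  rwa [← Set.range_comp] at this

end Main

end RieszOperator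

/-! ### The theorem -/

theorem mainTheorem1 {E F : Type*}
    [NormedAddCommGroup E] [Lattice E] [HasSolidNorm E] [IsOrderedAddMonoid E]
    [NormedSpace ℝ E] [IsOrderedModule ℝ E]
    [NormedAddCommGroup F] [Lattice F] [HasSolidNorm F] [IsOrderedAddMonoid F]
    [NormedSpace ℝ F] [IsOrderedModule ℝ F] [CompleteSpace F]
    (T : E →ₗ[ℝ] F) :
    (RieszOperator.IsOrderBoundedOp T → RieszOperator.IsKBSpace F →
      ∃ M : E →ₗ[ℝ] F, RieszOperator.IsModulus M T ∧
        RieszOperator.IsBWeaklyCompact T ∧ RieszOperator.IsBWeaklyCompact M) ∧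
    (∀ M : E →ₗ[ℝ] F, RieszOperator.IsModulus M T →
      RieszOperator.IsBWeaklyCompact M → RieszOperator.IsBWeaklyCompact T) := by
  have hdom : ∀ M : E →ₗ[ℝ] F, RieszOperator.IsModulus M T → ∀ x, ‖T x‖ ≤ ‖M |x|‖ :=
    fun M hM x => norm_le_norm_of_abs_le_abs ((hM.abs_apply_le x).trans (le_abs_self _))
  refine ⟨fun hT hF => ?_, fun M hM hMc => ?_⟩
  · obtain ⟨M, hM⟩ := RieszOperator.exists_isModulus hF.exists_isLUB hT
    have hC : ∀ u : ℕ → E, Monotone u → (∀ n, 0 ≤ u n) →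
        RieszOperator.IsBOrderBounded (Set.range u) → CauchySeq fun n => M (u n) :=
      fun u hu hu0 hub => hF.cauchySeq_map hM.nonneg hu hu0 hub
    refine ⟨M, hM, RieszOperator.isBWeaklyCompact_of_dominated hM.nonneg (hdom M hM) hC,
      RieszOperator.isBWeaklyCompact_of_dominated hM.nonneg (fun x => ?_) hC⟩
    -- A positive operator dominates itself: `|M x| ≤ M |x|`.
    refine norm_le_norm_of_abs_le_abs (sup_le ?_ ?_)
    · exact (RieszOperator.map_le_map_of_nonneg hM.nonneg (le_abs_self x)).trans (le_abs_self _)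
    · rw [← map_neg]
      exact (RieszOperator.map_le_map_of_nonneg hM.nonneg (neg_le_abs x)).trans (le_abs_self _)
  · exact RieszOperator.isBWeaklyCompact_of_dominated hM.nonneg (hdom M hM)
      fun u hu _ hub => hMc.cauchySeq_map hM.nonneg hu hub
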